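/- Let $\mathbb N=\{1,2,3,\dots\}$. A dynamical system $(X,f)$ is a compact metric space $(X,d)$ with a continuous map $f\colon X\to X$. For $x\in X$ and $U\subset X$ put $N_f(x,U)=\{n\in\mathbb N: f^n(x)\in U\}$. The point $x$ is recurrent if $N_f(x,U)\neq\emptyset$ for every open $U\ni x$. For a family $\mathcal F$ of subsets of $\mathbb N$, $x$ is $\mathcal F$-recurrent if $N_f(x,U)\in\mathcal F$ for every open $U\ni x$. The point $x$ is $\mathcal F$-product recurrent ($\mathcal F$-PR) if it is recurrent and, for every dynamical system $(Y,g)$ and every $\mathcal F$-recurrent point $y$ of $(Y,g)$, the pair $(x,y)$ is recurrent for $(X\times Y,f\times g)$. The point $x$ is distal if there is no $y\neq x$ in the closure of $\{f^n(x):n\in\mathbb N\}$ such that $\lim_{k\to\infty} d(f^{n_k}(x),f^{n_k}(y))=0$ for some strictly increasing sequence $(n_k)$ in $\mathbb N$. A set $A\subset\mathbb N$ is thick if for every $n\in\mathbb N$ there is $i\in\mathbb N$ with $\{i,i+1,\dots,i+n\}\subset A$; syndetic if there is $N\in\mathbb N$ such that $\{i,\dots,i+N\}\cap A\neq\emptyset$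 for all $i\in\mathbb N$; and piecewise syndetic if it is the intersection of a thick set and a syndetic set. Let $\mathcal F_{inf}$, $\mathcal F_{pubd}$ and $\mathcal F_{ps}$ be the families of the infinite sets, of the sets $A$ with positive upper Banach density, i.e. $\limsup_{n-m\to\infty}\frac{\#(A\cap\{m,\dots,n\})}{n-m+1}>0$, and of the piecewise syndetic sets, respectively. Theorem. Let $(X,f)$ be a dynamical system and $x\in X$. If $x$ is $\mathcal F_{ps}$-PR, then $x$ is distal. Moreover, the properties $\mathcal F_{inf}$-PR, $\mathcal F_{pubd}$-PR and $\mathcal F_{ps}$-PR of $x$ are equivalent. -/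

import Mathlib

open Filter Topology

universe u v

namespace ProductRecurrence

/-! Sets of return times are sets of positive integers. They are represented as sets of natural
numbers that do not contain `0`, and all the notions of size below look at positive integers only. -/

/-- The set of return (or transfer) times `N_f(x, U) = {n ≥ 1 : f^n(x) ∈ U}`. -/
def returnTimes {X : Type u} (f : X → X) (x : X) (U : Set X) : Set ℕ :=
  {n | 0 < n ∧ f^[n] x ∈ U}

/-- The positive orbit `{f^n(x) : n ≥ 1}`. -/
def posOrbit {X : Type u} (f : X → X) (x : X) : Set X :=
  {z | ∃ n : ℕ, 0 < n ∧ f^[n] x = z}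

/-- `x` is a recurrent point: it returns to each of its open neighbourhoods. -/
def IsRecurrent {X : Type u} [TopologicalSpace X] (f : X → X) (x : X) : Prop :=
  ∀ U : Set X, IsOpen U → x ∈ U → (returnTimes f x U).Nonempty

/-- `x` is `F`-recurrent, for a family `F` of sets of positive integers. -/
def IsFamilyRecurrent {X : Type u} [TopologicalSpace X] (F : Set (Set ℕ)) (f : X → X) (x : X) :
    Prop :=
  ∀ U : Set X, IsOpen U → x ∈ U → returnTimes f x U ∈ F

/-- The pair `x, y` is proximal: `d(f^{n_k}(x), f^{n_k}(y)) → 0` along some strictly increasing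
sequence of positive integers `n_k`. -/
def IsProximal {X : Type u} [MetricSpace X] (f : X → X) (x y : X) : Prop :=
  ∃ n : ℕ → ℕ, StrictMono n ∧ (∀ k, 0 < n k) ∧
    Tendsto (fun k => dist (f^[n k] x) (f^[n k] y)) atTop (𝓝 0)

/-- `x` is a distal point: it is not proximal to any point of its orbit closure other than
itself. -/
def IsDistal {X : Type u} [MetricSpace X] (f : X → X) (x : X) : Prop :=
  ∀ y ∈ closure (posOrbit f x), y ≠ x → ¬ IsProximal f x y

/-- A set of positive integers is thick if it contains arbitrarily long blocks
`{i, i + 1, …, i + n}`. -/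
def IsThick (A : Set ℕ) : Prop :=
  ∀ n : ℕ, 0 < n → ∃ i : ℕ, 0 < i ∧ Set.Icc i (i + n) ⊆ A

/-- A set of positive integers is syndetic if it has bounded gaps. -/
def IsSyndetic (A : Set ℕ) : Prop :=
  ∃ N : ℕ, 0 < N ∧ ∀ i : ℕ, 0 < i → (Set.Icc i (i + N) ∩ A).Nonempty

/-- The filter on pairs `(m, n)` of positive integers that expresses `n - m → ∞`. -/
noncomputable def lengthAtTop : Filter (ℕ × ℕ) :=
  comap (fun p : ℕ × ℕ => (p.2 : ℤ) - (p.1 : ℤ)) atTop ⊓ 𝓟 {p : ℕ × ℕ | 0 < p.1}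

/-- The upper Banach density
`limsup_{n - m → ∞} #(A ∩ {m, …, n}) / (n - m + 1)`. -/
noncomputable def upperBanachDensity (A : Set ℕ) : ℝ :=
  limsup (fun p : ℕ × ℕ =>
    ((A ∩ Set.Icc p.1 p.2).ncard : ℝ) / ((p.2 : ℝ) - (p.1 : ℝ) + 1)) lengthAtTop

/-- The family of infinite sets. -/
def familyInf : Set (Set ℕ) := {A | A.Infinite}

/-- The family of sets of positive upper Banach density. -/
def familyPubd : Set (Set ℕ) := {A | 0 < upperBanachDensity A}

/-- The family of piecewise syndetic sets: intersections of a thick set and a syndetic set. -/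
def familyPs : Set (Set ℕ) :=
  {A | ∃ T S : Set ℕ, IsThick T ∧ IsSyndetic S ∧ A = T ∩ S}

/-- `x` is `F`-product recurrent (`F`-PR): it is recurrent, and `(x, y)` is recurrent for `f × g`
whenever `y` is an `F`-recurrent point of a dynamical system `(Y, g)`, that is, of a continuous
self-map `g` of a compact metric space `Y`. -/
def IsFamilyPR (F : Set (Set ℕ)) {X : Type u} [MetricSpace X] (f : X → X) (x : X) : Prop :=
  IsRecurrent f x ∧
    ∀ (Y : Type v) [MetricSpace Y] [CompactSpace Y] (g : Y → Y), Continuous g →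
      ∀ y : Y, IsFamilyRecurrent F g y → IsRecurrent (Prod.map f g) (x, y)

end ProductRecurrence

namespace ProductRecurrence

-- Ultrafilters on `ℕ+` act on points by limits along orbits. A distal point is fixed by every
-- idempotent, and a recurrent point by some idempotent, so their pair is recurrent: distal implies
-- PR for infinite sets. PR is antitone in the family, so the inclusions ps ⊆ pubd ⊆ inf close the
-- cycle once ps-PR implies distal. For that, suppose `x` is not distal. An idempotent `p` in a
-- minimal left ideal moves `x` (`exists_minimal_idempotent_of_not_isDistal`); separate `x` and its
-- `p`-limit by open `U`, `V`. The times at which `x` visits `V` belong to `p`. Idempotence and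
-- minimality yield inside them a set `B` for which the indicator of `B ∪ {0}` is a ps-recurrent
-- point of the full shift (`exists_isSelfTranslating_subset`,
-- `IsSelfTranslating.exists_selfSimilar`). This point returns to the cylinder of its first symbol
-- only at times in `B`, when `x` is in `V` and not in `U`, so the pair is not recurrent.

attribute [local instance] Ultrafilter.add Ultrafilter.addSemigroup

/-! ### Minimal closed left ideals -/

/-- A nonempty closed left ideal of an additive semigroup with a topology. -/
structure IsClosedLeftIdeal {M : Type*} [Add M] [TopologicalSpace M] (L : Set M) : Prop where
  isClosed : IsClosed L
  nonempty : L.Nonempty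
  add_mem : ∀ m, ∀ l ∈ L, m + l ∈ L

theorem IsClosedLeftIdeal.exists_minimal_subset {M : Type*} [Add M] [TopologicalSpace M]
    [CompactSpace M] {I : Set M} (hI : IsClosedLeftIdeal I) :
    ∃ L ⊆ I, Minimal IsClosedLeftIdeal L := by
  refine zorn_superset_nonempty {L : Set M | IsClosedLeftIdeal L} (fun c hc hchain hne => ?_) I hI
  refine ⟨⋂₀ c, ⟨isClosed_sInter fun t ht => (hc ht).isClosed, ?_, ?_⟩,
    fun s hs => Set.sInter_subset_of_mem hs⟩
  · have := hne.to_subtype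
    exact IsCompact.nonempty_sInter_of_directed_nonempty_isCompact_isClosed
      (IsChain.directedOn hchain.symm) (fun U hU => (hc hU).nonempty)
      (fun U hU => (hc hU).isClosed.isCompact) (fun U hU => (hc hU).isClosed)
  · exact fun m l hl t ht => (hc ht).add_mem m l (hl t ht)

/-- In a minimal closed left ideal, every element is reached from every other one. -/
theorem exists_add_eq_of_minimal {M : Type*} [AddSemigroup M] [TopologicalSpace M]
    [CompactSpace M] [T2Space M] (hM : ∀ r : M, Continuous (· + r)) {L : Set M}
    (hL : Minimal IsClosedLeftIdeal L) {r q : M} (hr : r ∈ L) (hq : q ∈ L) :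
    ∃ s ∈ L, s + r = q := by
  -- `L + r` is a closed left ideal inside `L`, so minimality makes it all of `L`.
  have key : IsClosedLeftIdeal ((· + r) '' L) := by
    refine ⟨(hM r).isClosedMap _ hL.prop.isClosed, hL.prop.nonempty.image _, ?_⟩
    rintro m _ ⟨l, hl, rfl⟩
    exact ⟨m + l, hL.prop.add_mem _ _ hl, add_assoc _ _ _⟩
  have hsub : (· + r) '' L ⊆ L := by
    rintro _ ⟨l, -, rfl⟩
    exact hL.prop.add_mem _ _ hr
  have := hL.le_of_le key hsub hq
  exact this

theorem exists_idempotent_mem_closed {s : Set (Ultrafilter ℕ+)} (hne : s.Nonempty)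
    (hs : IsClosed s) (hadd : ∀ p ∈ s, ∀ q ∈ s, p + q ∈ s) : ∃ p ∈ s, p + p = p :=
  exists_idempotent_in_compact_add_subsemigroup Ultrafilter.continuous_add_left s hne hs.isCompact
    hadd

/-! ### Limits of orbits along ultrafilters -/

theorem isRecurrent_iff_mem_closure {X : Type*} [TopologicalSpace X] {f : X → X} {x : X} :
    IsRecurrent f x ↔ x ∈ closure (posOrbit f x) := by
  rw [mem_closure_iff]
  refine forall₃_congr fun U _ _ => ?_
  constructor
  · rintro ⟨n, hn, h⟩
    exact ⟨_, h, n, hn, rfl⟩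
  · rintro ⟨_, h, n, hn, rfl⟩
    exact ⟨n, hn, h⟩

section Limits

variable {X : Type*} [TopologicalSpace X] [CompactSpace X] [T2Space X] {f : X → X}

/-- The limit of `f^n(x)` along an ultrafilter on the positive integers. -/
noncomputable def orbitLim (f : X → X) (p : Ultrafilter ℕ+) (x : X) : X :=
  Ultrafilter.extend (fun n : ℕ+ => f^[n] x) p

theorem continuous_orbitLim (f : X → X) (x : X) : Continuous fun p => orbitLim f p x :=
  continuous_ultrafilter_extend _

theorem orbitLim_eq_iff {p : Ultrafilter ℕ+} {x z : X} :
    orbitLim f p x = z ↔ Tendsto (fun n : ℕ+ => f^[n] x) p (𝓝 z) :=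
  ultrafilter_extend_eq_iff

theorem tendsto_orbitLim (f : X → X) (p : Ultrafilter ℕ+) (x : X) :
    Tendsto (fun n : ℕ+ => f^[n] x) p (𝓝 (orbitLim f p x)) :=
  orbitLim_eq_iff.1 rfl

/-- The semigroup of ultrafilters acts on `X`. Only the finite iterates need to be continuous, since
the inner limit is taken with `m` fixed. -/
theorem orbitLim_add (hf : Continuous f) (p q : Ultrafilter ℕ+) (x : X) :
    orbitLim f (p + q) x = orbitLim f p (orbitLim f q x) := by
  rw [orbitLim_eq_iff, tendsto_nhds]
  intro U hU hz
  refine (Ultrafilter.eventually_add p q fun n : ℕ+ => f^[n] x ∈ U).2 ?_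
  filter_upwards [(tendsto_orbitLim f p (orbitLim f q x)).eventually (hU.mem_nhds hz)] with m hm
  filter_upwards [(((hf.iterate m).tendsto _).comp (tendsto_orbitLim f q x)).eventually
    (hU.mem_nhds hm)] with n hn
  change f^[m] (f^[n] x) ∈ U at hn
  simpa [Function.iterate_add_apply] using hn

theorem orbitLim_mem_closure (p : Ultrafilter ℕ+) (x : X) :
    orbitLim f p x ∈ closure (posOrbit f x) :=
  mem_closure_of_tendsto (tendsto_orbitLim f p x) (Eventually.of_forall fun n => ⟨n, n.pos, rfl⟩)

theorem exists_orbitLim_eq_of_mem_closure {x y : X} (hy : y ∈ closure (posOrbit f x)) :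
    ∃ p, orbitLim f p x = y := by
  have : (comap (fun n : ℕ+ => f^[n] x) (𝓝 y)).NeBot := by
    rw [comap_neBot_iff]
    intro t ht
    obtain ⟨_, h1, n, hn, rfl⟩ := mem_closure_iff_nhds.1 hy t ht
    exact ⟨⟨n, hn⟩, h1⟩
  obtain ⟨p, hp⟩ := Ultrafilter.exists_le (comap (fun n : ℕ+ => f^[n] x) (𝓝 y))
  exact ⟨p, orbitLim_eq_iff.2 (tendsto_iff_comap.2 hp)⟩

theorem isRecurrent_of_orbitLim_eq {p : Ultrafilter ℕ+} {x : X} (h : orbitLim f p x = x) :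
    IsRecurrent f x := by
  rw [isRecurrent_iff_mem_closure]
  have := orbitLim_mem_closure (f := f) p x
  rwa [h] at this

/-- A recurrent point is fixed by an idempotent ultrafilter. -/
theorem IsRecurrent.exists_idempotent (hf : Continuous f) {x : X} (hx : IsRecurrent f x) :
    ∃ p : Ultrafilter ℕ+, p + p = p ∧ orbitLim f p x = x := by
  obtain ⟨p, hp, h⟩ := exists_idempotent_mem_closed (s := {p | orbitLim f p x = x})
    (exists_orbitLim_eq_of_mem_closure (isRecurrent_iff_mem_closure.1 hx))
    (isClosed_eq (continuous_orbitLim f x) continuous_const) (fun p hp q hq => by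
      simp only [Set.mem_ofPred_eq] at hp hq ⊢
      rw [orbitLim_add hf, hq, hp])
  exact ⟨p, h, hp⟩

end Limits

/-- If `p` lives on `n > N`, then `p = p + p` lives on sums exceeding `N + 1`; so an idempotent is
not principal. -/
theorem exists_gt_mem_of_idempotent {p : Ultrafilter ℕ+} (hp : p + p = p) {A : Set ℕ+}
    (hA : A ∈ p) (N : ℕ) : ∃ n ∈ A, N < n := by
  have hinf : ∀ N : ℕ, ∀ᶠ n : ℕ+ in p, N < n := by
    intro N
    induction N with
    | zero => exact Eventually.of_forall fun n => n.pos
    | succ N ih =>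
      rw [← hp]
      refine (Ultrafilter.eventually_add p p fun n : ℕ+ => N + 1 < n).2 ?_
      filter_upwards [ih] with m hm
      filter_upwards with n
      have := n.pos
      push_cast
      omega
  obtain ⟨n, h1, h2⟩ := ((hinf N).and hA).exists
  exact ⟨n, h2, h1⟩

/-! ### Distality and proximality in terms of ultrafilters. -/

section Distal

variable {X : Type*} [MetricSpace X] [CompactSpace X] {f : X → X}

theorem isProximal_of_orbitLim_eq {p : Ultrafilter ℕ+} (hp : p + p = p) {x y : X}
    (h : orbitLim f p x = orbitLim f p y) : IsProximal f x y := by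
  have hlim : Tendsto (fun n : ℕ+ => dist (f^[n] x) (f^[n] y)) p (𝓝 0) := by
    simpa [h] using (tendsto_orbitLim f p x).dist (tendsto_orbitLim f p y)
  have hex : ∀ k N : ℕ, ∃ n : ℕ, N < n ∧ dist (f^[n] x) (f^[n] y) < 1 / ((k : ℝ) + 1) := by
    intro k N
    obtain ⟨n, hn, hN⟩ := exists_gt_mem_of_idempotent hp
      (hlim.eventually (gt_mem_nhds (Nat.one_div_pos_of_nat (n := k)))) N
    exact ⟨n, hN, hn⟩
  choose F hF1 hF2 using hex
  let n : ℕ → ℕ := fun k => Nat.rec (F 0 0) (fun k m => F (k + 1) m) k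
  have hmono : StrictMono n := strictMono_nat_of_lt_succ fun k => hF1 _ _
  refine ⟨n, hmono, fun k => ?_, ?_⟩
  · exact (hF1 0 0).trans_le (hmono.monotone (Nat.zero_le k))
  · refine squeeze_zero (fun _ => dist_nonneg) (fun k => ?_) tendsto_one_div_add_atTop_nhds_zero_nat
    cases k with
    | zero => exact (hF2 0 0).le
    | succ k => exact (hF2 (k + 1) _).le

theorem IsProximal.exists_orbitLim_eq {x y : X} (h : IsProximal f x y) :
    ∃ p, orbitLim f p x = orbitLim f p y := by
  obtain ⟨n, -, hpos, hlim⟩ := h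
  let k : ℕ → ℕ+ := fun i => ⟨n i, hpos i⟩
  obtain ⟨p, hp⟩ := Ultrafilter.exists_le (map k atTop)
  refine ⟨p, ?_⟩
  have h1 : Tendsto (fun n : ℕ+ => dist (f^[n] x) (f^[n] y)) (map k atTop) (𝓝 0) :=
    tendsto_map'_iff.2 hlim
  have h2 := (tendsto_orbitLim f p x).dist (tendsto_orbitLim f p y)
  exact dist_eq_zero.1 (tendsto_nhds_unique h2 (h1.mono_left hp))

/-- Idempotence gives `x` and its `p`-limit the same `p`-limit, so they are proximal. -/
theorem IsDistal.orbitLim_eq (hf : Continuous f) {x : X} (hx : IsDistal f x)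
    {p : Ultrafilter ℕ+} (hp : p + p = p) : orbitLim f p x = x := by
  by_contra hne
  refine hx _ (orbitLim_mem_closure p x) hne (isProximal_of_orbitLim_eq hp ?_)
  rw [← orbitLim_add hf, hp]

theorem isRecurrent_prodMap_of_orbitLim_eq {Y : Type*} [MetricSpace Y] [CompactSpace Y] {g : Y → Y}
    {p : Ultrafilter ℕ+} {x : X} {y : Y} (hx : orbitLim f p x = x) (hy : orbitLim g p y = y) :
    IsRecurrent (Prod.map f g) (x, y) := by
  refine isRecurrent_of_orbitLim_eq (p := p) (orbitLim_eq_iff.2 ?_)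
  simpa [Prod.map_iterate] using (orbitLim_eq_iff.1 hx).prodMk_nhds (orbitLim_eq_iff.1 hy)

/-- Furstenberg: a distal point is product recurrent. -/
theorem IsDistal.isFamilyPR_familyInf {X : Type u} [MetricSpace X] [CompactSpace X] {f : X → X}
    (hf : Continuous f) {x : X} (hx : IsDistal f x) : IsFamilyPR.{u, v} familyInf f x := by
  constructor
  · obtain ⟨p, -, hp⟩ := exists_idempotent_mem_closed (s := Set.univ) Set.univ_nonempty
      isClosed_univ (fun _ _ _ _ => Set.mem_univ _)
    exact isRecurrent_of_orbitLim_eq (hx.orbitLim_eq hf hp)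
  · intro Y _ _ g hg y hy
    have hrec : IsRecurrent g y := fun U hU hyU => (hy U hU hyU).nonempty
    obtain ⟨p, hp, hpy⟩ := hrec.exists_idempotent hg
    exact isRecurrent_prodMap_of_orbitLim_eq (hx.orbitLim_eq hf hp) hpy

/-- A point that is not distal is moved by an idempotent of a minimal left ideal. -/
theorem exists_minimal_idempotent_of_not_isDistal (hf : Continuous f) {x : X}
    (hx : ¬ IsDistal f x) : ∃ L : Set (Ultrafilter ℕ+), Minimal IsClosedLeftIdeal L ∧
      ∃ p ∈ L, p + p = p ∧ orbitLim f p x ≠ x := by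
  simp only [IsDistal, not_forall, not_not] at hx
  obtain ⟨y, hy, hne, hprox⟩ := hx
  have hI : IsClosedLeftIdeal {p | orbitLim f p x = orbitLim f p y} :=
    ⟨isClosed_eq (continuous_orbitLim f x) (continuous_orbitLim f y), hprox.exists_orbitLim_eq,
      fun m l hl => by
        simp only [Set.mem_ofPred_eq] at hl ⊢
        rw [orbitLim_add hf, orbitLim_add hf, hl]⟩
  obtain ⟨L, hLI, hL⟩ := hI.exists_minimal_subset
  refine ⟨L, hL, ?_⟩
  obtain ⟨u, huL, hu⟩ := exists_idempotent_mem_closed hL.prop.nonempty hL.prop.isClosed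
    (fun p _ q hq => hL.prop.add_mem p q hq)
  -- If `u` fixes `x`, some `r + u ∈ L` sends `x` to `y`, and `w + (r + u) = r + u` forces `w` to
  -- fix `y`. An idempotent `q ∈ L` fixing `y` then sends `x` to `y`, because all of `L` identifies
  -- the two.
  by_cases hux : orbitLim f u x = x
  swap
  · exact ⟨u, huL, hu, hux⟩
  obtain ⟨r, hr⟩ := exists_orbitLim_eq_of_mem_closure hy
  have hruL : r + u ∈ L := hL.prop.add_mem _ _ huL
  obtain ⟨w, hwL, hw⟩ := exists_add_eq_of_minimal Ultrafilter.continuous_add_left hL hruL hruL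
  have hruy : orbitLim f (r + u) x = y := by rw [orbitLim_add hf, hux, hr]
  obtain ⟨q, ⟨hqL, hqy⟩, hq⟩ := exists_idempotent_mem_closed
    (s := L ∩ {q | orbitLim f q y = y})
    ⟨w, hwL, by
      rw [Set.mem_ofPred_eq]
      nth_rewrite 1 [← hruy]
      rw [← orbitLim_add hf, hw, hruy]⟩
    (hL.prop.isClosed.inter (isClosed_eq (continuous_orbitLim f y) continuous_const))
    (fun p hp q hq => ⟨hL.prop.add_mem _ _ hq.1, by
      have h1 := hp.2
      have h2 := hq.2
      simp only [Set.mem_ofPred_eq] at h1 h2 ⊢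
      rw [orbitLim_add hf, h2, h1]⟩)
  refine ⟨q, hqL, hq, ?_⟩
  rw [show orbitLim f q x = orbitLim f q y from hLI hqL]
  exact fun h => hne (hqy.symm.trans h)

end Distal

/-! ### Piecewise syndetic sets -/

/-- There is a gap bound `d` such that `A` has gaps at most `d` on arbitrarily long blocks
arbitrarily far out. -/
def HasBoundedGapsOnBlocks (A : Set ℕ) : Prop :=
  ∃ d : ℕ, ∀ n N : ℕ, ∃ i ≥ N, ∀ t ≤ n, ∃ a ∈ A, i + t ≤ a ∧ a ≤ i + t + d

theorem HasBoundedGapsOnBlocks.mono {A B : Set ℕ} (hA : HasBoundedGapsOnBlocks A) (h : A ⊆ B) :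
    HasBoundedGapsOnBlocks B := by
  obtain ⟨d, hd⟩ := hA
  refine ⟨d, fun n N => ?_⟩
  obtain ⟨i, hi, H⟩ := hd n N
  refine ⟨i, hi, fun t ht => ?_⟩
  obtain ⟨a, ha, h2⟩ := H t ht
  exact ⟨a, h ha, h2⟩

theorem HasBoundedGapsOnBlocks.mem_familyPs {A : Set ℕ} (hA : HasBoundedGapsOnBlocks A) :
    A ∈ familyPs := by
  obtain ⟨d, hd⟩ := hA
  -- Points followed by an element of `A` within distance `d`. Then `A = T ∩ (A ∪ Tᶜ)`, with `T`
  -- thick and `A ∪ Tᶜ` syndetic.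
  let T : Set ℕ := {t | ∃ a ∈ A, t ≤ a ∧ a ≤ t + d}
  refine ⟨T, A ∪ Tᶜ, fun n _ => ?_, ⟨d + 1, d.succ_pos, fun i _ => ?_⟩, ?_⟩
  · obtain ⟨i, hi, H⟩ := hd n 1
    refine ⟨i, hi, fun t ht => ?_⟩
    obtain ⟨h1, h2⟩ := ht
    obtain ⟨k, rfl⟩ := Nat.exists_eq_add_of_le h1
    exact H k (by omega)
  · by_cases hi : i ∈ T
    · obtain ⟨a, ha, h1, h2⟩ := hi
      exact ⟨a, ⟨h1, by omega⟩, Or.inl ha⟩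
    · exact ⟨i, ⟨le_rfl, by omega⟩, Or.inr hi⟩
  · ext a
    constructor
    · exact fun ha => ⟨⟨a, ha, le_rfl, by omega⟩, Or.inl ha⟩
    · rintro ⟨h1, h2 | h2⟩
      · exact h2
      · exact absurd h1 h2

/-- Members of ultrafilters in a minimal left ideal are piecewise syndetic. -/
theorem hasBoundedGapsOnBlocks_of_mem {L : Set (Ultrafilter ℕ+)}
    (hL : Minimal IsClosedLeftIdeal L) {q : Ultrafilter ℕ+} (hq : q ∈ L) {A : Set ℕ+} (hA : A ∈ q) :
    HasBoundedGapsOnBlocks ((↑) '' A : Set ℕ) := by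
  -- Since `q = s + r`, some translate of `A` belongs to `r`. By compactness finitely many
  -- translates serve all of `L`, in particular every `pure k + q`; their largest shift bounds the
  -- gaps.
  have hcover : L ⊆ ⋃ m : ℕ+, {r : Ultrafilter ℕ+ | {n | m + n ∈ A} ∈ r} := by
    intro r hr
    obtain ⟨s, -, rfl⟩ := exists_add_eq_of_minimal Ultrafilter.continuous_add_left hL hr hq
    obtain ⟨m, hm⟩ := ((Ultrafilter.eventually_add s r fun n => n ∈ A).1 hA).exists
    exact Set.mem_iUnion.2 ⟨m, hm⟩
  obtain ⟨F, hF⟩ := hL.prop.isClosed.isCompact.elim_finite_subcover _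
    (fun m => ultrafilter_isOpen_basic _) hcover
  have hD : ∀ r ∈ L, ∀ᶠ n in (r : Filter ℕ+), ∃ m ∈ F, m + n ∈ A := by
    intro r hr
    obtain ⟨m, hm, h⟩ := Set.mem_iUnion₂.1 (hF hr)
    exact mem_of_superset h fun n hn => ⟨m, hm, hn⟩
  have hshift : ∀ k : ℕ+, ∀ᶠ n in (q : Filter ℕ+), ∃ m ∈ F, m + (k + n) ∈ A := by
    intro k
    have h1 := hD _ (hL.prop.add_mem (pure k) q hq)
    exact (Ultrafilter.eventually_add (pure k) q fun n => ∃ m ∈ F, m + n ∈ A).1 h1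
  refine ⟨F.sup (fun m => (m : ℕ)), fun n N => ?_⟩
  have hall : ∀ᶠ i in (q : Filter ℕ+), ∀ k ∈ Finset.range (n + 1), ∃ m ∈ F,
      m + ((N + k).succPNat + i) ∈ A := by
    rw [eventually_all_finset]
    exact fun k _ => hshift _
  obtain ⟨i, hi⟩ := hall.exists
  refine ⟨N + 1 + i, by omega, fun t ht => ?_⟩
  obtain ⟨m, hm, h⟩ := hi t (Finset.mem_range.2 (by omega))
  have h3 : (m : ℕ) ≤ F.sup (fun m => (m : ℕ)) := Finset.le_sup (f := fun m : ℕ+ => (m : ℕ)) hm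
  refine ⟨_, ⟨_, h, rfl⟩, ?_, ?_⟩ <;> simp only [PNat.add_coe, Nat.succPNat_coe] <;> omega

/-- Sets `G` of positive integers such that every finite subset of `G` has a piecewise syndetic set
of translations by elements of `G` that keep it inside `G`. -/
structure IsSelfTranslating (G : Set ℕ) : Prop where
  pos : ∀ n ∈ G, 0 < n
  translate : ∀ W : Finset ℕ, ↑W ⊆ G → HasBoundedGapsOnBlocks {n | n ∈ G ∧ ∀ w ∈ W, n + w ∈ G}

/-- Take `G` to be the `n ∈ A` with `A - n ∈ p`. Idempotence puts `G` and each `G - n`, for `n ∈ G`,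
in `p`; finite intersections of these stay in `p` and so are piecewise syndetic. -/
theorem exists_isSelfTranslating_subset {L : Set (Ultrafilter ℕ+)}
    (hL : Minimal IsClosedLeftIdeal L) {p : Ultrafilter ℕ+} (hpL : p ∈ L) (hp : p + p = p)
    {A : Set ℕ+} (hA : A ∈ p) : ∃ G : Set ℕ, G ⊆ (↑) '' A ∧ IsSelfTranslating G := by
  have hidem : ∀ B : Set ℕ+, B ∈ p → ∀ᶠ m in (p : Filter ℕ+), ∀ᶠ n in (p : Filter ℕ+), m + n ∈ B :=
    fun B hB => (Ultrafilter.eventually_add p p fun n => n ∈ B).1 (hp.symm ▸ hB)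
  let S : Set ℕ+ := {n | n ∈ A ∧ ∀ᶠ m in (p : Filter ℕ+), n + m ∈ A}
  have hS : S ∈ p := Filter.inter_mem hA (hidem A hA)
  have hSS : ∀ n ∈ S, ∀ᶠ m in (p : Filter ℕ+), m + n ∈ S := by
    rintro n ⟨-, hn⟩
    filter_upwards [hn, hidem {m | n + m ∈ A} hn] with m h1 h2
    rw [add_comm]
    refine ⟨h1, ?_⟩
    filter_upwards [h2] with k hk
    rw [add_assoc]
    exact hk
  refine ⟨(↑) '' S, Set.image_mono fun n hn => hn.1, ⟨?_, fun W hW => ?_⟩⟩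
  · rintro _ ⟨n, -, rfl⟩
    exact n.pos
  · have hall : ∀ᶠ m in (p : Filter ℕ+), m ∈ S ∧ ∀ w ∈ W, (m : ℕ) + w ∈ ((↑) '' S : Set ℕ) := by
      refine Filter.Eventually.and hS ?_
      rw [eventually_all_finset]
      intro w hw
      obtain ⟨n, hn, rfl⟩ := hW hw
      filter_upwards [hSS n hn] with m hm
      exact ⟨_, hm, by simp⟩
    refine (hasBoundedGapsOnBlocks_of_mem hL hpL hall).mono ?_
    rintro _ ⟨m, hm, rfl⟩
    exact ⟨⟨m, hm.1, rfl⟩, hm.2⟩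

/-! ### Self-similar subsets -/

/-- A block of separated copies of `W ∪ {0}`, read up to length `j`. -/
theorem IsSelfTranslating.exists_block {G : Set ℕ} (hG : IsSelfTranslating G) (W : Finset ℕ)
    (hW : ↑W ⊆ G) (j : ℕ) :
    ∃ D : ℕ, ∀ n N : ℕ, ∃ E : Finset ℕ, ↑E ⊆ G ∧ (∀ e ∈ E, N ≤ e) ∧ ∃ i ≥ N, ∀ t ≤ n,
      ∃ a, i + t ≤ a ∧ a ≤ i + t + D ∧ ∀ s ≤ j, (a + s ∈ E ↔ s = 0 ∨ s ∈ W) := by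
  obtain ⟨d, hd⟩ := hG.translate W hW
  -- A copy starts within `d` of its cell and has length `j + 1`, so spacing `d + j + 1` keeps
  -- copies disjoint.
  obtain ⟨q, hq⟩ : ∃ q, q = d + j + 1 := ⟨_, rfl⟩
  refine ⟨q + d, fun n N => ?_⟩
  obtain ⟨i, hi, H⟩ := hd ((n + 1) * q) N
  have H' : ∀ c : ℕ, ∃ a, c ≤ n + 1 → (a ∈ G ∧ ∀ w ∈ W, a + w ∈ G) ∧ i + c * q ≤ a ∧
      a ≤ i + c * q + d := by
    intro c
    by_cases hc : c ≤ n + 1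
    · obtain ⟨a, ha⟩ := H (c * q) (Nat.mul_le_mul_right q hc)
      exact ⟨a, fun _ => ha⟩
    · exact ⟨0, fun h => absurd h hc⟩
  choose a ha using H'
  let P : Finset ℕ := (insert 0 W).filter (· ≤ j)
  refine ⟨(Finset.range (n + 2)).biUnion fun c => P.image (a c + ·), ?_, ?_, i, hi, ?_⟩
  · intro e he
    simp only [Finset.coe_biUnion, Set.mem_iUnion, Finset.mem_coe, Finset.mem_range,
      Finset.mem_image, P, Finset.mem_filter, Finset.mem_insert] at he
    obtain ⟨c, hc, w, ⟨rfl | hw, -⟩, rfl⟩ := he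
    · exact (ha c (by omega)).1.1
    · exact (ha c (by omega)).1.2 w hw
  · intro e he
    simp only [Finset.mem_biUnion, Finset.mem_range, Finset.mem_image] at he
    obtain ⟨c, hc, w, -, rfl⟩ := he
    have := (ha c (by omega)).2.1
    omega
  · intro t ht
    -- The next cell starts in `(i + t, i + t + q]`, whence the bound `q + d`.
    have hc : t / q + 1 ≤ n + 1 := Nat.succ_le_succ ((Nat.div_le_self _ _).trans ht)
    have hdiv := Nat.div_add_mod' t q
    have hmod := Nat.mod_lt t (show 0 < q by omega)
    obtain ⟨-, h1, h2⟩ := ha _ hc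
    rw [add_mul, one_mul] at h1 h2
    refine ⟨a (t / q + 1), by omega, by omega, fun s hs => ?_⟩
    simp only [Finset.mem_biUnion, Finset.mem_range, Finset.mem_image, P, Finset.mem_filter,
      Finset.mem_insert]
    constructor
    · rintro ⟨c, hcn, w, ⟨hw, hwj⟩, he⟩
      obtain ⟨-, h3, h4⟩ := ha c (by omega)
      have hcc : c = t / q + 1 := by
        rcases lt_trichotomy c (t / q + 1) with h | h | h
        · have := Nat.mul_le_mul_right q (Nat.lt_succ_iff.1 h)
          omega
        · exact h
        · have := Nat.mul_le_mul_right q (Nat.succ_le_of_lt h)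
          rw [Nat.succ_eq_add_one, add_mul, add_mul, one_mul] at this
          omega
      subst hcc
      obtain rfl : w = s := by omega
      exact hw
    · exact fun hw => ⟨_, by omega, s, ⟨hw, hs⟩, rfl⟩

/-- A self-translating set contains a set `B` such that `B ∪ {0}` recurs along piecewise syndetic
sets of positions. -/
theorem IsSelfTranslating.exists_selfSimilar {G : Set ℕ} (hG : IsSelfTranslating G) :
    ∃ B ⊆ G, ∀ j : ℕ, HasBoundedGapsOnBlocks
      {a | 0 < a ∧ ∀ s ≤ j, ((a + s = 0 ∨ a + s ∈ B) ↔ (s = 0 ∨ s ∈ B))} := by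
  have hblock := fun W : {W : Finset ℕ // ↑W ⊆ G} => hG.exists_block W.1 W.2
  choose D hD using hblock
  -- A state is a finite part of `B` and a bound below which membership is settled.
  let St := {p : Finset ℕ × ℕ // ↑p.1 ⊆ G ∧ ∀ b ∈ p.1, b < p.2}
  let word : St → ℕ → {W : Finset ℕ // ↑W ⊆ G} := fun p j =>
    ⟨p.1.1.filter (· ≤ j), fun b hb => p.2.1 (Finset.mem_of_mem_filter b hb)⟩
  -- Stage `k` copies the current word up to `j = k.unpair.1` along a block of length `k`, beyond
  -- the settled range. Each `j` is treated at infinitely many stages.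
  have hstep : ∀ (k : ℕ) (p : St), ∃ p' : St, p.1.2 < p'.1.2 ∧
      (∀ b < p.1.2, b ∈ p'.1.1 ↔ b ∈ p.1.1) ∧ ∃ i ≥ p.1.2, ∀ t ≤ k, ∃ a, i + t ≤ a ∧
        a ≤ i + t + D (word p k.unpair.1) k.unpair.1 ∧ a + k.unpair.1 < p'.1.2 ∧
        ∀ s ≤ k.unpair.1, (a + s ∈ p'.1.1 ↔ s = 0 ∨ s ∈ (word p k.unpair.1).1) := by
    intro k p
    obtain ⟨E, hEG, hEN, i, hi, H⟩ := hD (word p k.unpair.1) k.unpair.1 k p.1.2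
    refine ⟨⟨(p.1.1 ∪ E, p.1.2 + E.sup id + i + k + D (word p k.unpair.1) k.unpair.1
      + k.unpair.1 + 1), ?_, ?_⟩, ?_, ?_, i, hi, fun t ht => ?_⟩
    · rw [Finset.coe_union]
      exact Set.union_subset p.2.1 hEG
    · intro b hb
      rcases Finset.mem_union.1 hb with hb | hb
      · have := p.2.2 b hb
        dsimp only
        omega
      · have : b ≤ E.sup id := Finset.le_sup (f := id) hb
        dsimp only
        omega
    · dsimp only
      omega
    · intro b hb
      rw [Finset.mem_union, or_iff_left]
      intro hbE
      have := hEN b hbE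
      omega
    · obtain ⟨a, h1, h2, h3⟩ := H t ht
      refine ⟨a, h1, h2, ?_, fun s hs => ?_⟩
      · dsimp only
        omega
      · rw [← h3 s hs, Finset.mem_union, or_iff_right]
        intro hb
        have := p.2.2 _ hb
        omega
  choose next hlt hold hnew using hstep
  let p : ℕ → St := fun k => Nat.rec ⟨(∅, 1), by simp, by simp⟩ (fun k q => next k q) k
  have hM : StrictMono fun k => (p k).1.2 := strictMono_nat_of_lt_succ fun k => hlt k (p k)
  have hM1 : ∀ k, k < (p k).1.2 := by
    intro k
    induction k with
    | zero => exact Nat.one_pos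
    | succ k ih => exact lt_of_le_of_lt (Nat.succ_le_of_lt ih) (hlt k (p k))
  have hstable : ∀ k l, k ≤ l → ∀ b < (p k).1.2, (b ∈ (p l).1.1 ↔ b ∈ (p k).1.1) := by
    intro k l hkl b hb
    induction l, hkl using Nat.le_induction with
    | base => exact Iff.rfl
    | succ l hkl ih =>
      rw [← ih]
      exact hold l (p l) b (hb.trans_le (hM.monotone hkl))
  let B : Set ℕ := {b | ∃ k, b ∈ (p k).1.1}
  have hB : ∀ k, ∀ b < (p k).1.2, (b ∈ B ↔ b ∈ (p k).1.1) := by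
    intro k b hb
    refine ⟨fun ⟨l, hl⟩ => ?_, fun h => ⟨k, h⟩⟩
    rcases le_total k l with h | h
    · exact (hstable k l h b hb).1 hl
    · exact (hstable l k h b ((p l).2.2 b hl)).2 hl
  refine ⟨B, fun b ⟨k, hk⟩ => (p k).2.1 hk, fun j => ?_⟩
  -- The word up to `j` is final from stage `j` on, so one gap bound serves all later blocks.
  have hword : ∀ k, j ≤ k → word (p k) j = word (p j) j := by
    intro k hk
    apply Subtype.ext
    ext b
    simp only [word, Finset.mem_filter]
    refine and_congr_left fun hb => ?_
    exact hstable j k hk b (hb.trans_lt (hM1 j))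
  refine ⟨D (word (p j) j) j, fun n N => ?_⟩
  obtain ⟨k, hkj, hkn⟩ : ∃ k, k.unpair.1 = j ∧ n + N ≤ k :=
    ⟨Nat.pair j (n + N), by simp, Nat.right_le_pair _ _⟩
  have hjk : j ≤ k := hkj ▸ Nat.unpair_left_le k
  obtain ⟨i, hi, H⟩ := hnew k (p k)
  have hki := hM1 k
  refine ⟨i, by omega, fun t ht => ?_⟩
  obtain ⟨a, h1, h2, h3, h4⟩ := H t (by omega)
  rw [hkj] at h2 h3 h4
  rw [hword k hjk] at h2
  refine ⟨a, ⟨by omega, fun s hs => ?_⟩, h1, h2⟩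
  have e1 : a + s ∈ B ↔ a + s ∈ (next k (p k)).1.1 := hB (k + 1) (a + s) (by
    change a + s < (next k (p k)).1.2
    omega)
  rw [or_iff_right (by omega), e1, h4 s hs, hB k s (by omega)]
  simp only [word, Finset.mem_filter, hs, and_true]

/-! ### Comparison of the families -/

theorem IsFamilyPR.anti {F F' : Set (Set ℕ)} (h : F ⊆ F') {X : Type u} [MetricSpace X] {f : X → X}
    {x : X} (hx : IsFamilyPR.{u, v} F' f x) : IsFamilyPR.{u, v} F f x :=
  ⟨hx.1, fun Y _ _ g hg y hy => hx.2 Y g hg y fun U hU hyU => h (hy U hU hyU)⟩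

theorem ncard_inter_Icc_le (A : Set ℕ) (m n : ℕ) :
    (A ∩ Set.Icc m n).ncard ≤ n + 1 - m := by
  refine (Set.ncard_le_ncard Set.inter_subset_right (Set.finite_Icc m n)).trans ?_
  rw [← Finset.coe_Icc, Set.ncard_coe_finset, Nat.card_Icc]

theorem eventually_lengthAtTop (k : ℕ) :
    ∀ᶠ p : ℕ × ℕ in lengthAtTop, 0 < p.1 ∧ p.1 + k ≤ p.2 := by
  have h1 : ∀ᶠ p : ℕ × ℕ in lengthAtTop, (k : ℤ) ≤ (p.2 : ℤ) - p.1 :=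
    (tendsto_comap.eventually (eventually_ge_atTop (k : ℤ))).filter_mono inf_le_left
  have h2 : ∀ᶠ p : ℕ × ℕ in lengthAtTop, 0 < p.1 :=
    Eventually.filter_mono inf_le_right (mem_principal_self _)
  filter_upwards [h1, h2] with p h1 h2
  exact ⟨h2, by omega⟩

theorem frequently_lengthAtTop {P : ℕ × ℕ → Prop}
    (h : ∀ k : ℕ, ∃ p : ℕ × ℕ, 0 < p.1 ∧ p.1 + k ≤ p.2 ∧ P p) : ∃ᶠ p in lengthAtTop, P p := by
  rw [frequently_iff]
  intro U hU
  rw [lengthAtTop, mem_inf_principal, mem_comap] at hU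
  obtain ⟨t, ht, hsub⟩ := hU
  obtain ⟨a, ha⟩ := mem_atTop_sets.1 ht
  obtain ⟨p, h1, h2, h3⟩ := h a.toNat
  exact ⟨p, hsub (ha _ (show a ≤ (p.2 : ℤ) - p.1 by omega)) h1, h3⟩

instance : lengthAtTop.NeBot := by
  rw [neBot_iff]
  intro h
  have := frequently_lengthAtTop (P := fun _ => True) fun k => ⟨(1, 1 + k), one_pos, le_rfl, trivial⟩
  rw [h] at this
  exact this (by simp)

theorem familyPubd_subset_familyInf : familyPubd ⊆ familyInf := by
  intro A hA
  rw [familyInf, Set.mem_ofPred_eq]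
  intro hfin
  refine (lt_irrefl (0 : ℝ)) (lt_of_lt_of_eq hA ?_)
  refine Tendsto.limsup_eq ?_
  have hlen : Tendsto (fun p : ℕ × ℕ => (p.2 : ℝ) - (p.1 : ℝ) + 1) lengthAtTop atTop := by
    refine tendsto_atTop.2 fun b => ?_
    filter_upwards [eventually_lengthAtTop ⌈b⌉₊] with p hp
    have h1 := Nat.le_ceil b
    have h2 : (p.1 : ℝ) + ⌈b⌉₊ ≤ p.2 := by exact_mod_cast hp.2
    linarith
  refine squeeze_zero' ?_ ?_ (hlen.const_div_atTop (A.ncard : ℝ))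
  · filter_upwards [hlen.eventually_ge_atTop 0] with p hp
    exact div_nonneg (Nat.cast_nonneg _) hp
  · filter_upwards [hlen.eventually_ge_atTop 0] with p hp
    refine div_le_div_of_nonneg_right ?_ hp
    exact_mod_cast Set.ncard_le_ncard Set.inter_subset_left hfin

/-- Each of `c` disjoint cells of length `d + 1` contributes a point. -/
theorem le_ncard_inter_Icc {A : Set ℕ} {i d c : ℕ}
    (h : ∀ t < c, (Set.Icc (i + t * (d + 1)) (i + t * (d + 1) + d) ∩ A).Nonempty) :
    c ≤ (A ∩ Set.Icc i (i + c * (d + 1))).ncard := by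
  have h' : ∀ t, ∃ a, t < c → a ∈ Set.Icc (i + t * (d + 1)) (i + t * (d + 1) + d) ∩ A := by
    intro t
    by_cases ht : t < c
    · obtain ⟨a, ha⟩ := h t ht
      exact ⟨a, fun _ => ha⟩
    · exact ⟨0, fun h => absurd h ht⟩
  choose a ha using h'
  have hlt : ∀ s t, s < t → t < c → a s < a t := by
    intro s t hst ht
    have h1 := (ha s (hst.trans ht)).1.2
    have h2 := (ha t ht).1.1
    have h3 := Nat.mul_le_mul_right (d + 1) (Nat.succ_le_of_lt hst)
    rw [Nat.succ_eq_add_one, add_mul, one_mul] at h3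
    omega
  have hinj : Set.InjOn a (Finset.range c : Finset ℕ) := by
    intro s hs t ht hst
    have hs' := Finset.mem_range.1 hs
    have ht' := Finset.mem_range.1 ht
    rcases lt_trichotomy s t with h | h | h
    · exact absurd hst (hlt s t h ht').ne
    · exact h
    · exact absurd hst (hlt t s h hs').ne'
  have hcard : ((Finset.range c).image a).card = c := by
    rw [Finset.card_image_of_injOn hinj, Finset.card_range]
  calc c = ((Finset.range c).image a : Set ℕ).ncard := by
        rw [Set.ncard_coe_finset, hcard]
    _ ≤ _ := by
        refine Set.ncard_le_ncard ?_ ((Set.finite_Icc _ _).subset Set.inter_subset_right)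
        intro b hb
        obtain ⟨t, ht, rfl⟩ := Finset.mem_image.1 (Finset.mem_coe.1 hb)
        have htc := Finset.mem_range.1 ht
        obtain ⟨⟨h1, h2⟩, h3⟩ := ha t htc
        have h4 := Nat.mul_le_mul_right (d + 1) (Nat.succ_le_of_lt htc)
        rw [Nat.succ_eq_add_one, add_mul, one_mul] at h4
        exact ⟨h3, by omega, by omega⟩

theorem familyPs_subset_familyPubd : familyPs ⊆ familyPubd := by
  rintro _ ⟨T, S, hT, ⟨d, -, hS⟩, rfl⟩
  -- A block of `(k + 1)(d + 1) + 1` integers in `T` holds at least `k + 1` points of `S`; the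
  -- factor 2 absorbs the extra integer.
  have hpos : (0 : ℝ) < 1 / (2 * (d + 1)) := by positivity
  refine hpos.trans_le ?_
  refine le_limsup_of_frequently_le (frequently_lengthAtTop fun k => ?_) ?_
  · obtain ⟨i, hi, hiT⟩ := hT ((k + 1) * (d + 1)) (by positivity)
    refine ⟨(i, i + (k + 1) * (d + 1)), hi, ?_, ?_⟩
    · have := Nat.mul_le_mul_left (k + 1) (Nat.succ_le_succ (Nat.zero_le d))
      dsimp only
      simp only [Nat.succ_eq_add_one] at this
      omega
    · have hc : k + 1 ≤ ((T ∩ S) ∩ Set.Icc i (i + (k + 1) * (d + 1))).ncard := by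
        refine le_ncard_inter_Icc fun t ht => ?_
        obtain ⟨a, ha, haS⟩ := hS (i + t * (d + 1)) (by omega)
        have h4 := Nat.mul_le_mul_right (d + 1) (Nat.succ_le_of_lt ht)
        rw [Nat.succ_eq_add_one, add_mul t, one_mul] at h4
        exact ⟨a, ha, hiT ⟨by have := ha.1; omega, by have := ha.2; omega⟩, haS⟩
      have hc' : ((k : ℝ) + 1) ≤ (((T ∩ S) ∩ Set.Icc i (i + (k + 1) * (d + 1))).ncard : ℝ) := by
        exact_mod_cast hc
      dsimp only
      push_cast
      rw [div_le_div_iff₀ (by positivity) (by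
        nlinarith [(Nat.cast_nonneg k : (0 : ℝ) ≤ k), (Nat.cast_nonneg d : (0 : ℝ) ≤ d)])]
      nlinarith [(Nat.cast_nonneg k : (0 : ℝ) ≤ k), (Nat.cast_nonneg d : (0 : ℝ) ≤ d)]
  -- A real `limsup` needs the quotients to be bounded above.
  · refine ⟨1, ?_⟩
    rw [eventually_map]
    filter_upwards [eventually_lengthAtTop 0] with p hp
    have h1 : (p.1 : ℝ) ≤ p.2 := by exact_mod_cast hp.2
    rw [div_le_one (by linarith)]
    have h2 := ncard_inter_Icc_le (T ∩ S) p.1 p.2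
    have h3 : ((T ∩ S) ∩ Set.Icc p.1 p.2).ncard + p.1 ≤ p.2 + 1 := by omega
    have h4 : ((((T ∩ S) ∩ Set.Icc p.1 p.2).ncard : ℕ) : ℝ) + p.1 ≤ p.2 + 1 := by exact_mod_cast h3
    linarith

/-! ### Product recurrence with piecewise syndetic recurrence implies distality -/

theorem iterate_shift {α : Type*} (y : ℕ → α) (n s : ℕ) :
    (fun (z : ℕ → α) i => z (i + 1))^[n] y s = y (n + s) := by
  induction n generalizing y with
  | zero => simp
  | succ n ih =>
    rw [Function.iterate_succ_apply, ih]
    congr 1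
    omega

open Classical in
/-- If each initial word of the indicator of `B ∪ {0}` occurs along a piecewise syndetic set, then
some piecewise syndetically recurrent point returns to one of its neighbourhoods only at times
in `B`. -/
theorem exists_familyPs_recurrent {B : Set ℕ}
    (hB : ∀ j : ℕ, HasBoundedGapsOnBlocks
      {a | 0 < a ∧ ∀ s ≤ j, ((a + s = 0 ∨ a + s ∈ B) ↔ (s = 0 ∨ s ∈ B))}) :
    ∃ (Y : Type v) (_ : MetricSpace Y) (_ : CompactSpace Y) (g : Y → Y) (y : Y) (W : Set Y),
      Continuous g ∧ IsFamilyRecurrent familyPs g y ∧ IsOpen W ∧ y ∈ W ∧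
        returnTimes g y W ⊆ B := by
  let y : ℕ → ULift.{v} Bool := fun s => ⟨decide (s = 0 ∨ s ∈ B)⟩
  have h0 : Continuous fun z : ℕ → ULift.{v} Bool => z 0 := continuous_apply 0
  have hW : IsOpen {z : ℕ → ULift.{v} Bool | z 0 = ⟨true⟩} :=
    (isOpen_discrete {(⟨true⟩ : ULift.{v} Bool)}).preimage h0
  refine ⟨ℕ → ULift.{v} Bool, TopologicalSpace.metrizableSpaceMetric _, inferInstance,
    fun z i => z (i + 1), y, {z | z 0 = ⟨true⟩}, by fun_prop, ?_, ?_, by simp [y], ?_⟩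
  · intro U hU hyU
    -- A neighbourhood of `y` constrains finitely many coordinates, so recurrence of the initial
    -- word up to `I.sup id` suffices.
    obtain ⟨I, u, hu, hsub⟩ := isOpen_pi_iff.1 hU y hyU
    refine ((hB (I.sup id)).mono ?_).mem_familyPs
    rintro a ⟨ha, h⟩
    refine ⟨ha, hsub fun s hs => ?_⟩
    have hs' : s ≤ I.sup id := Finset.le_sup (f := id) hs
    rw [iterate_shift, show y (a + s) = y s by simp only [y, h s hs']]
    exact (hu s hs).2
  · exact hW
  · rintro n ⟨hn, h⟩
    rw [Set.mem_ofPred_eq, iterate_shift] at h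
    simp only [y, ULift.up.injEq, decide_eq_true_eq, add_zero] at h
    exact h.resolve_left hn.ne'

theorem isDistal_of_isFamilyPR_familyPs {X : Type u} [MetricSpace X] [CompactSpace X] {f : X → X}
    (hf : Continuous f) {x : X} (hx : IsFamilyPR.{u, v} familyPs f x) : IsDistal f x := by
  by_contra hdist
  obtain ⟨L, hL, p, hpL, hp, hne⟩ := exists_minimal_idempotent_of_not_isDistal hf hdist
  obtain ⟨U, V, hU, hV, hxU, hpV, hUV⟩ := t2_separation hne.symm
  obtain ⟨G, hGA, hG⟩ := exists_isSelfTranslating_subset hL hpL hp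
    ((tendsto_orbitLim f p x).eventually (hV.mem_nhds hpV))
  obtain ⟨B, hBG, hB⟩ := hG.exists_selfSimilar
  obtain ⟨Y, _, _, g, y, W, hg, hy, hW, hyW, hsub⟩ := exists_familyPs_recurrent.{v} hB
  -- A joint return time lies in `B`, which puts `f^[n] x` in both `U` and `V`.
  obtain ⟨n, hn, h⟩ := hx.2 Y g hg y hy (U ×ˢ W) (hU.prod hW) ⟨hxU, hyW⟩
  rw [Prod.map_iterate] at h
  obtain ⟨m, hm, rfl⟩ := hGA (hBG (hsub ⟨hn, h.2⟩))
  exact Set.disjoint_left.1 hUV h.1 hm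

end ProductRecurrence

theorem theorem3p2 {X : Type u} [MetricSpace X] [CompactSpace X] (f : X → X) (hf : Continuous f)
    (x : X) :
    (ProductRecurrence.IsFamilyPR.{u, v} ProductRecurrence.familyPs f x →
      ProductRecurrence.IsDistal f x) ∧
    (ProductRecurrence.IsFamilyPR.{u, v} ProductRecurrence.familyInf f x ↔
      ProductRecurrence.IsFamilyPR.{u, v} ProductRecurrence.familyPubd f x) ∧
    (ProductRecurrence.IsFamilyPR.{u, v} ProductRecurrence.familyPubd f x ↔
      ProductRecurrence.IsFamilyPR.{u, v} ProductRecurrence.familyPs f x) := by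
  have h := fun hx => ProductRecurrence.isDistal_of_isFamilyPR_familyPs.{u, v} (x := x) hf hx
  have hinf := fun hx => (h hx).isFamilyPR_familyInf.{u, v} hf
  exact ⟨h, ⟨fun hx => hx.anti ProductRecurrence.familyPubd_subset_familyInf,
      fun hx => hinf (hx.anti ProductRecurrence.familyPs_subset_familyPubd)⟩,
    ⟨fun hx => hx.anti ProductRecurrence.familyPs_subset_familyPubd,
      fun hx => (hinf hx).anti ProductRecurrence.familyPubd_subset_familyInf⟩⟩
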